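/- Let $k=\mathbb C$ or $k=\mathbb R$. All Lie groups are finite-dimensional (analytic) Lie groups over $k$, Hausdorff and second countable; in particular, for $k=\mathbb C$ they are complex Lie groups and morphisms between them are holomorphic. A pair $(\mathfrak g_1,\mathfrak g_2)$ is a matched pair of Lie algebras over $k$ if $\mathfrak g_1,\mathfrak g_2$ are Lie subalgebras of a Lie algebra $\mathfrak g$ over $k$ with $\mathfrak g=\mathfrak g_1\oplus\mathfrak g_2$ as vector spaces. A pair $(G_1,G_2)$ of Lie groups over $k$ is a matched pair of Lie groups if there are a Lie group $G$ over $k$, a homomorphism $i:G_1\to G$ and an anti-homomorphism $j:G_2\to G$ of Lie groups over $k$, both having closed image and being homeomorphisms onto their images, such that $i(G_1)\cap j(G_2)=\{e\}$ and the complement of $i(G_1)\,j(G_2)$ in $G$ has Haar measure zero. A matched pair $(\mathfrak g_1,\mathfrak g_2)$ of Lie algebras in $\mathfrak g$ can be exponentiated to a matched pair of Lie groups $(G_1,G_2)$ if $G,i,j$ as above can be chosen such that there is an isomorphism of Lie algebras over $k$ from the Lie algebra of $G$ onto $\mathfrak g$ that sends the Lie algebra of the closed subgroup $i(G_1)$ onto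 $\mathfrak g_1$ and the Lie algebra of the closed subgroup $j(G_2)$ onto $\mathfrak g_2$. **Proposition.** (1) Every matched pair $(\mathfrak g_1,\mathfrak g_2)$ of complex Lie algebras with $\dim_{\mathbb C}\mathfrak g_1=\dim_{\mathbb C}\mathfrak g_2=1$ (that is, $\mathfrak g_1=\mathfrak g_2=\mathbb C$) can be exponentiated to a matched pair of complex Lie groups $(G_1,G_2)$ in which each of $G_1,G_2$ is either $(\mathbb C,+)$ or $(\mathbb C\setminus\{0\},\cdot)$. (2) Every matched pair $(\mathfrak g_1,\mathfrak g_2)$ of real Lie algebras with $\dim_{\mathbb R}\mathfrak g_1=\dim_{\mathbb R}\mathfrak g_2=1$ (that is, $\mathfrak g_1=\mathfrak g_2=\mathbb R$) can be exponentiated to a matched pair of real Lie groups $(G_1,G_2)$ in which each of $G_1,G_2$ is either $(\mathbb R,+)$ or $(\mathbb R\setminus\{0\},\cdot)$. -/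

import Mathlib

open scoped Manifold ContDiff
open MeasureTheory

noncomputable section

namespace LieMatchedPair

/-! ### The additive group `(𝕜, +)` as a Lie group

`Multiplicative 𝕜` is Mathlib's multiplicatively written copy of `(𝕜, +)`; it is given the manifold
structure of `𝕜` (one global chart, the identity).  The multiplicative group `𝕜 ∖ {0}` is `𝕜ˣ`,
whose Lie group structure (as an open subset of `𝕜`) is in Mathlib. -/

section Additive

variable {𝕜 : Type*} [NontriviallyNormedField 𝕜]

theorem isOpenEmbedding_toAdd :
    Topology.IsOpenEmbedding (Multiplicative.toAdd : Multiplicative 𝕜 → 𝕜) :=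
  (Homeomorph.refl 𝕜).isOpenEmbedding

instance instChartedSpaceMultiplicative : ChartedSpace 𝕜 (Multiplicative 𝕜) :=
  isOpenEmbedding_toAdd.singletonChartedSpace

instance instIsManifoldMultiplicative {n : WithTop ℕ∞} :
    IsManifold 𝓘(𝕜, 𝕜) n (Multiplicative 𝕜) :=
  isOpenEmbedding_toAdd.isManifold_singleton

theorem contMDiff_toAdd {n : WithTop ℕ∞} :
    ContMDiff 𝓘(𝕜, 𝕜) 𝓘(𝕜, 𝕜) n (Multiplicative.toAdd : Multiplicative 𝕜 → 𝕜) :=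
  contMDiff_isOpenEmbedding isOpenEmbedding_toAdd

instance instLieGroupMultiplicative {n : WithTop ℕ∞} :
    LieGroup 𝓘(𝕜, 𝕜) n (Multiplicative 𝕜) where
  contMDiff_mul := by
    apply ContMDiff.of_comp_isOpenEmbedding isOpenEmbedding_toAdd
    exact (contMDiff_toAdd.comp contMDiff_fst).add (contMDiff_toAdd.comp contMDiff_snd)
  contMDiff_inv := by
    apply ContMDiff.of_comp_isOpenEmbedding isOpenEmbedding_toAdd
    exact contMDiff_toAdd.neg

end Additive

/-- `(𝔤₁, 𝔤₂)` is a matched pair of Lie algebras: Lie subalgebras of `𝔤` with `𝔤 = 𝔤₁ ⊕ 𝔤₂` as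
vector spaces. -/
def IsMatchedPairLieAlgebra {𝕜 : Type*} [Field 𝕜] {𝔤 : Type*} [LieRing 𝔤] [LieAlgebra 𝕜 𝔤]
    (𝔤₁ 𝔤₂ : LieSubalgebra 𝕜 𝔤) : Prop :=
  IsCompl 𝔤₁.toSubmodule 𝔤₂.toSubmodule

section Groups

variable {𝕜 : Type*} [RCLike 𝕜]
  {E : Type*} [NormedAddCommGroup E] [NormedSpace 𝕜 E]
  {E₁ : Type*} [NormedAddCommGroup E₁] [NormedSpace 𝕜 E₁]
  {E₂ : Type*} [NormedAddCommGroup E₂] [NormedSpace 𝕜 E₂]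
  {G : Type*} [Group G] [TopologicalSpace G] [ChartedSpace E G] [MeasurableSpace G]
  {G₁ : Type*} [Group G₁] [TopologicalSpace G₁] [ChartedSpace E₁ G₁]
  {G₂ : Type*} [Group G₂] [TopologicalSpace G₂] [ChartedSpace E₂ G₂]

/-- The Lie groups `G₁`, `G₂` form a matched pair of Lie groups inside the Lie group `G` (which
carries its Borel σ-algebra) through the morphism `i : G₁ → G` and the anti-morphism `j : G₂ → G`
of Lie groups over `𝕜`. -/
structure IsMatchedPairLieGroup (i : G₁ → G) (j : G₂ → G) : Prop where
  map_mul_left : ∀ g h : G₁, i (g * h) = i g * i h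
  map_mul_right : ∀ s t : G₂, j (s * t) = j t * j s
  contMDiff_left : ContMDiff 𝓘(𝕜, E₁) 𝓘(𝕜, E) ω i
  contMDiff_right : ContMDiff 𝓘(𝕜, E₂) 𝓘(𝕜, E) ω j
  isClosedEmbedding_left : Topology.IsClosedEmbedding i
  isClosedEmbedding_right : Topology.IsClosedEmbedding j
  range_inter_range : Set.range i ∩ Set.range j = {1}
  null_compl : ∀ μ : Measure G, μ.IsHaarMeasure →
    μ (Set.range fun p : G₁ × G₂ => i p.1 * j p.2)ᶜ = 0

/-- The tangent space at `1` of the image of `f : G₁ → G`, for `f` smooth with `f 1 = 1`: the range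
of the derivative of `f` at `1`, inside the Lie algebra `T₁ G` of `G`. When `f` is an injective
morphism or anti-morphism of Lie groups with closed image, it is the Lie algebra of the closed
subgroup `f(G₁)`. -/
def tangentImage (f : G₁ → G) : Set (GroupLieAlgebra 𝓘(𝕜, E) G) :=
  Set.range fun w : TangentSpace 𝓘(𝕜, E₁) (1 : G₁) =>
    (mfderiv 𝓘(𝕜, E₁) 𝓘(𝕜, E) f 1 w : TangentSpace 𝓘(𝕜, E) (f 1))

end Groups

/-- The matched pair `(𝔤₁, 𝔤₂)` of Lie algebras (inside `𝔤`) can be exponentiated to a matched pair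
of Lie groups `(G₁, G₂)`: there are a (second countable, Hausdorff, finite-dimensional) Lie group
`G` over `𝕜` and maps `i`, `j` that make `(G₁, G₂)` a matched pair of Lie groups, and an
isomorphism of the Lie algebra of `G` onto `𝔤` which sends the Lie algebra of `i(G₁)` onto `𝔤₁` and
that of `j(G₂)` onto `𝔤₂`. -/
def ExponentiatesTo {𝕜 : Type} [RCLike 𝕜] {𝔤 : Type*} [LieRing 𝔤] [LieAlgebra 𝕜 𝔤]
    (𝔤₁ 𝔤₂ : LieSubalgebra 𝕜 𝔤)
    {E₁ : Type*} [NormedAddCommGroup E₁] [NormedSpace 𝕜 E₁]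
    {E₂ : Type*} [NormedAddCommGroup E₂] [NormedSpace 𝕜 E₂]
    (G₁ : Type*) [Group G₁] [TopologicalSpace G₁] [ChartedSpace E₁ G₁] [LieGroup 𝓘(𝕜, E₁) ω G₁]
    (G₂ : Type*) [Group G₂] [TopologicalSpace G₂] [ChartedSpace E₂ G₂] [LieGroup 𝓘(𝕜, E₂) ω G₂] :
    Prop :=
  ∃ (E : Type) (_ : NormedAddCommGroup E) (_ : NormedSpace 𝕜 E) (_ : FiniteDimensional 𝕜 E)
    (_ : CompleteSpace E)
    (G : Type) (_ : Group G) (_ : TopologicalSpace G) (_ : ChartedSpace E G)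
    (_ : LieGroup 𝓘(𝕜, E) ω G) (_ : T2Space G) (_ : SecondCountableTopology G)
    (_ : MeasurableSpace G) (_ : BorelSpace G)
    (i : G₁ → G) (j : G₂ → G) (φ : GroupLieAlgebra 𝓘(𝕜, E) G ≃ₗ⁅𝕜⁆ 𝔤),
    IsMatchedPairLieGroup (𝕜 := 𝕜) (E := E) (E₁ := E₁) (E₂ := E₂) i j ∧
    φ '' tangentImage (𝕜 := 𝕜) (E := E) (E₁ := E₁) i = (𝔤₁ : Set 𝔤) ∧
    φ '' tangentImage (𝕜 := 𝕜) (E := E) (E₁ := E₂) j = (𝔤₂ : Set 𝔤)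

/-- `(𝔤₁, 𝔤₂)` can be exponentiated to a matched pair of Lie groups `(G₁, G₂)` where each of `G₁`
and `G₂` is either `(𝕜, +)` or `(𝕜 ∖ {0}, ·)`. -/
def ExponentiatesToAddOrMul {𝕜 : Type} [RCLike 𝕜] {𝔤 : Type*} [LieRing 𝔤] [LieAlgebra 𝕜 𝔤]
    (𝔤₁ 𝔤₂ : LieSubalgebra 𝕜 𝔤) : Prop :=
  ExponentiatesTo 𝔤₁ 𝔤₂ (E₁ := 𝕜) (E₂ := 𝕜) (Multiplicative 𝕜) (Multiplicative 𝕜) ∨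
  ExponentiatesTo 𝔤₁ 𝔤₂ (E₁ := 𝕜) (E₂ := 𝕜) (Multiplicative 𝕜) 𝕜ˣ ∨
  ExponentiatesTo 𝔤₁ 𝔤₂ (E₁ := 𝕜) (E₂ := 𝕜) 𝕜ˣ (Multiplicative 𝕜) ∨
  ExponentiatesTo 𝔤₁ 𝔤₂ (E₁ := 𝕜) (E₂ := 𝕜) 𝕜ˣ 𝕜ˣ

end LieMatchedPair

end

/-! Every bracket on a plane is determined by its value on a basis, hence has the form `⁅v, w⁆ = ℓ v
• w - ℓ w • v` for a linear form `ℓ`. Such an algebra integrates explicitly, over ℝ and ℂ alike: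
composition of the maps `x ↦ p + (1 + ℓ p) • x` makes the open set `1 + ℓ p ≠ 0` a Lie group with
exactly this bracket (`DilationGroup.lie_eq`).

A line `𝕜 v` meets this group in a closed subgroup, a copy of `(𝕜, +)` if `ℓ v = 0`, and otherwise
of `𝕜ˣ` through `p ↦ 1 + ℓ p`. With `b = ℓ (1, 0)`, the two coordinate lines satisfy `(x, 0) * (0,
y) = (x, (1 + x * b) * y)`, so their product misses only the points with `1 + x * b = 0`, a Haar
null set (`haar_null_line`). -/

namespace LieMatchedPair

/-! ### Derivatives and Lie brackets in a global chart -/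

section GlobalChart

open Filter Topology

variable {𝕜 : Type*} [NontriviallyNormedField 𝕜]
  {E : Type*} [NormedAddCommGroup E] [NormedSpace 𝕜 E]
  {E' : Type*} [NormedAddCommGroup E'] [NormedSpace 𝕜 E']
  {M : Type*} [TopologicalSpace M] [ChartedSpace E M]
  {M' : Type*} [TopologicalSpace M'] [ChartedSpace E' M']

/-- A map between manifolds with global charts `e`, `e'` has in these charts the derivative of its
coordinate expression. -/
theorem hasMFDerivAt_of_globalChart {e : M → E} {e' : M' → E'}
    (he : ∀ x : M, ⇑(extChartAt 𝓘(𝕜, E) x) = e)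
    (he' : ∀ x : M', ⇑(extChartAt 𝓘(𝕜, E') x) = e')
    {f : M → M'} {F : E → E'} {F' : E →L[𝕜] E'} {x : M} (hc : ContinuousAt f x)
    (h : ∀ y, e' (f y) = F (e y)) (hF : HasFDerivAt F F' (e x)) :
    HasMFDerivAt 𝓘(𝕜, E) 𝓘(𝕜, E') f x F' := by
  refine ⟨hc, ?_⟩
  have hx : extChartAt 𝓘(𝕜, E) x x = e x := by rw [he]
  rw [hx]
  refine HasFDerivAt.hasFDerivWithinAt ?_
  refine hF.congr_of_eventuallyEq ?_
  have ht : (extChartAt 𝓘(𝕜, E) x).target ∈ 𝓝 (e x) := by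
    rw [← hx]; exact extChartAt_target_mem_nhds x
  filter_upwards [ht] with y hy
  have h1 : e ((extChartAt 𝓘(𝕜, E) x).symm y) = y := by
    rw [← he x]; exact (extChartAt 𝓘(𝕜, E) x).right_inv hy
  simp only [writtenInExtChartAt, Function.comp_apply, he', h, h1]

/-- In a global chart, the Lie bracket of two vector fields is the Lie bracket of their coordinate
expressions. -/
theorem mlieBracket_of_globalChart [IsRCLikeNormedField 𝕜] [CompleteSpace E]
    [IsManifold 𝓘(𝕜, E) ω M] {e : M → E}
    (he : ∀ x : M, ⇑(extChartAt 𝓘(𝕜, E) x) = e) (hec : ContMDiff 𝓘(𝕜, E) 𝓘(𝕜, E) ω e)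
    {V W : (x : M) → TangentSpace 𝓘(𝕜, E) x} {V' W' : (y : E) → TangentSpace 𝓘(𝕜, E) y}
    (hV : ∀ x, (V x : E) = V' (e x)) (hW : ∀ x, (W x : E) = W' (e x))
    (hV' : ContDiff 𝕜 ω V') (hW' : ContDiff 𝕜 ω W') (x : M) :
    (VectorField.mlieBracket 𝓘(𝕜, E) V W x : E) = VectorField.lieBracket 𝕜 V' W' (e x) := by
  -- Read in the chart `e`, the map `e` itself is the identity, so pulling a field back along `e` is
  -- mere composition with `e`.
  have hd (y : M) : mfderiv 𝓘(𝕜, E) 𝓘(𝕜, E) e y = ContinuousLinearMap.id 𝕜 E :=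
    (hasMFDerivAt_of_globalChart (F := id) he (e' := id) (fun _ => rfl) hec.continuous.continuousAt
      (fun _ => rfl) (hasFDerivAt_id _)).mfderiv
  have hp (U : (y : E) → TangentSpace 𝓘(𝕜, E) y) (y : M) :
      (VectorField.mpullback 𝓘(𝕜, E) 𝓘(𝕜, E) e U y : E) = U (e y) := by
    have h : VectorField.mpullback 𝓘(𝕜, E) 𝓘(𝕜, E) e U y =
      (ContinuousLinearMap.id 𝕜 E).inverse (U (e y)) := by
      rw [VectorField.mpullback_apply, hd]; rfl
    exact h.trans (by rw [ContinuousLinearMap.inverse_id]; rfl)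
  have hVp : V = VectorField.mpullback 𝓘(𝕜, E) 𝓘(𝕜, E) e V' :=
    funext fun y => (hV y).trans (hp V' y).symm
  have hWp : W = VectorField.mpullback 𝓘(𝕜, E) 𝓘(𝕜, E) e W' :=
    funext fun y => (hW y).trans (hp W' y).symm
  rw [hVp, hWp, ← VectorField.mpullback_mlieBracket (n := ω)]
  · refine (hp _ x).trans ?_
    rw [← VectorField.mlieBracketWithin_univ, VectorField.mlieBracketWithin_eq_lieBracketWithin]
    exact congrFun (VectorField.lieBracketWithin_univ (E := E)) _
  · exact ((contMDiff_vectorSpace_iff_contDiff).2 hV').mdifferentiable (by simp) _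
  · exact ((contMDiff_vectorSpace_iff_contDiff).2 hW').mdifferentiable (by simp) _
  · exact hec.contMDiffAt
  · exact minSmoothness_of_isRCLikeNormedField.le.trans le_top

end GlobalChart

/-! ### The group of dilations and its Lie algebra -/

section DilationGroup

variable {𝕜 : Type*} [RCLike 𝕜] {E : Type*} [NormedAddCommGroup E] [NormedSpace 𝕜 E]

/-- For a linear form `ℓ` on `E`, the set of all `p` with `1 + ℓ p ≠ 0`; it is a Lie group for the
multiplication `p * q = p + (1 + ℓ p) • q`, which is the composition of the affine maps
`x ↦ p + (1 + ℓ p) • x`. -/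
def DilationGroup (ℓ : E →L[𝕜] 𝕜) : Type _ := {p : E // 1 + ℓ p ≠ 0}

namespace DilationGroup

variable {ℓ : E →L[𝕜] 𝕜}

instance : TopologicalSpace (DilationGroup ℓ) :=
  inferInstanceAs (TopologicalSpace {p : E // 1 + ℓ p ≠ 0})

/-- The global chart of `DilationGroup ℓ`. -/
def toVec (p : DilationGroup ℓ) : E := p.1

theorem one_add_ne_zero (p : DilationGroup ℓ) : 1 + ℓ p.toVec ≠ 0 := p.2

@[ext] theorem ext {p q : DilationGroup ℓ} (h : p.toVec = q.toVec) : p = q := Subtype.ext h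

theorem isOpenEmbedding_toVec :
    Topology.IsOpenEmbedding (toVec : DilationGroup ℓ → E) :=
  (isOpen_ne_fun (by fun_prop) continuous_const :
    IsOpen {p : E | 1 + ℓ p ≠ 0}).isOpenEmbedding_subtypeVal

/-- Linear parts of affine maps multiply under composition; this gives closure under the product. -/
theorem one_add_mul (p q : E) : 1 + ℓ (p + (1 + ℓ p) • q) = (1 + ℓ p) * (1 + ℓ q) := by
  simp only [map_add, map_smul, smul_eq_mul]; ring

theorem one_add_inv {p : E} (hp : 1 + ℓ p ≠ 0) :
    1 + ℓ (-((1 + ℓ p)⁻¹ • p)) = (1 + ℓ p)⁻¹ := by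
  simp only [map_neg, map_smul, smul_eq_mul]; field_simp; ring

instance : Mul (DilationGroup ℓ) :=
  ⟨fun p q => ⟨p.1 + (1 + ℓ p.1) • q.1, by rw [one_add_mul]; exact mul_ne_zero p.2 q.2⟩⟩

instance : One (DilationGroup ℓ) := ⟨⟨0, by simp⟩⟩

instance : Inv (DilationGroup ℓ) :=
  ⟨fun p => ⟨-((1 + ℓ p.1)⁻¹ • p.1), by rw [one_add_inv p.2]; exact inv_ne_zero p.2⟩⟩

theorem toVec_mul (p q : DilationGroup ℓ) :
    (p * q).toVec = p.toVec + (1 + ℓ p.toVec) • q.toVec := rfl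

theorem toVec_one : (1 : DilationGroup ℓ).toVec = 0 := rfl

theorem toVec_inv (p : DilationGroup ℓ) :
    p⁻¹.toVec = -((1 + ℓ p.toVec)⁻¹ • p.toVec) := rfl

instance : Group (DilationGroup ℓ) :=
  Group.ofLeftAxioms
    (fun p q r => by
      ext
      simp only [toVec_mul, one_add_mul]
      module)
    (fun p => by ext; simp [toVec_mul, toVec_one])
    (fun p => by
      ext
      rw [toVec_mul, toVec_inv, one_add_inv p.one_add_ne_zero, toVec_one, neg_add_cancel])

noncomputable instance : ChartedSpace E (DilationGroup ℓ) := isOpenEmbedding_toVec.singletonChartedSpace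

instance {n : WithTop ℕ∞} : IsManifold 𝓘(𝕜, E) n (DilationGroup ℓ) :=
  isOpenEmbedding_toVec.isManifold_singleton

theorem coe_extChartAt (p : DilationGroup ℓ) : ⇑(extChartAt 𝓘(𝕜, E) p) = toVec := rfl

theorem contMDiff_toVec {n : WithTop ℕ∞} :
    ContMDiff 𝓘(𝕜, E) 𝓘(𝕜, E) n (toVec : DilationGroup ℓ → E) :=
  contMDiff_isOpenEmbedding isOpenEmbedding_toVec

theorem contMDiff_iff_toVec {E₀ : Type*} [NormedAddCommGroup E₀] [NormedSpace 𝕜 E₀]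
    {H₀ : Type*} [TopologicalSpace H₀] {I : ModelWithCorners 𝕜 E₀ H₀}
    {M : Type*} [TopologicalSpace M] [ChartedSpace H₀ M] {n : WithTop ℕ∞} {f : M → DilationGroup ℓ}
    (hf : ContMDiff I 𝓘(𝕜, E) n fun x => (f x).toVec) : ContMDiff I 𝓘(𝕜, E) n f :=
  ContMDiff.of_comp_isOpenEmbedding isOpenEmbedding_toVec hf

instance {n : WithTop ℕ∞} : LieGroup 𝓘(𝕜, E) n (DilationGroup ℓ) where
  contMDiff_mul := by
    refine contMDiff_iff_toVec ?_
    have h : ContDiff 𝕜 n fun x : E × E => x.1 + (1 + ℓ x.1) • x.2 := by fun_prop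
    have h2 := (h.contMDiff (n := n)).comp
      ((contMDiff_toVec (ℓ := ℓ) (n := n)).comp contMDiff_fst |>.prodMk_space
      ((contMDiff_toVec (ℓ := ℓ) (n := n)).comp contMDiff_snd))
    exact h2
  contMDiff_inv := by
    refine contMDiff_iff_toVec fun p => ?_
    have h : ContDiffAt 𝕜 n (fun x : E => -((1 + ℓ x)⁻¹ • x)) p.toVec :=
      ((ContDiffAt.inv (f := fun x : E => 1 + ℓ x) (by fun_prop) p.one_add_ne_zero).smul contDiffAt_id).neg
    exact h.contMDiffAt.comp p contMDiff_toVec.contMDiffAt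

instance : T2Space (DilationGroup ℓ) := inferInstanceAs (T2Space {p : E // 1 + ℓ p ≠ 0})

instance [FiniteDimensional 𝕜 E] : SecondCountableTopology (DilationGroup ℓ) :=
  haveI : ProperSpace E := FiniteDimensional.proper_rclike 𝕜 E
  isOpenEmbedding_toVec.isEmbedding.secondCountableTopology

instance [FiniteDimensional 𝕜 E] : LocallyCompactSpace (DilationGroup ℓ) :=
  haveI : ProperSpace E := FiniteDimensional.proper_rclike 𝕜 E
  isOpenEmbedding_toVec.locallyCompactSpace

instance : IsTopologicalGroup (DilationGroup ℓ) :=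
  topologicalGroup_of_lieGroup 𝓘(𝕜, E) ω

/-- Left translation by `p` is affine in the chart, with linear part the scalar `1 + ℓ p`. -/
theorem mulInvariantVectorField_eq (v : GroupLieAlgebra 𝓘(𝕜, E) (DilationGroup ℓ))
    (p : DilationGroup ℓ) :
    (mulInvariantVectorField v p : E) = (1 + ℓ p.toVec) • (v : E) := by
  have h := hasMFDerivAt_of_globalChart (𝕜 := 𝕜) (x := (1 : DilationGroup ℓ)) (f := (p * ·))
    (F := fun q : E => p.toVec + (1 + ℓ p.toVec) • q) coe_extChartAt coe_extChartAt
    (by fun_prop) (fun q => toVec_mul p q)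
    (((hasFDerivAt_id (𝕜 := 𝕜) _).const_smul (1 + ℓ p.toVec)).const_add p.toVec)
  exact congrArg (fun L : E →L[𝕜] E => L v) h.mfderiv

theorem lieBracket_smul_const (v w : E) :
    VectorField.lieBracket 𝕜 (fun q => (1 + ℓ q) • v) (fun q => (1 + ℓ q) • w) 0 =
      ℓ v • w - ℓ w • v := by
  have h (u : E) : HasFDerivAt (fun q : E => (1 + ℓ q) • u) (ℓ.smulRight u) 0 :=
    (ℓ.hasFDerivAt.const_add 1).smul_const u
  rw [VectorField.lieBracket, (h v).fderiv, (h w).fderiv]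
  simp

theorem lie_eq [CompleteSpace E] (v w : GroupLieAlgebra 𝓘(𝕜, E) (DilationGroup ℓ)) :
    ⁅v, w⁆ = ℓ v • w - ℓ w • v :=
  (mlieBracket_of_globalChart (𝕜 := 𝕜) coe_extChartAt contMDiff_toVec
    (mulInvariantVectorField_eq v) (mulInvariantVectorField_eq w)
    (V' := fun q => (1 + ℓ q) • (v : E)) (W' := fun q => (1 + ℓ q) • (w : E))
    (by fun_prop) (by fun_prop) 1).trans (lieBracket_smul_const (E := E) v w)

end DilationGroup

end DilationGroup

/-! ### Lines as closed one-dimensional subgroups -/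

section Line

variable {𝕜 : Type*} [RCLike 𝕜] {E : Type*} [NormedAddCommGroup E] [NormedSpace 𝕜 E]
  {ℓ : E →L[𝕜] 𝕜}

/-- `i` is a closed embedding of the one-dimensional Lie group `A` into `DilationGroup ℓ` whose
image is the intersection of the group with the line spanned by `v`. -/
structure IsLineEmbedding (v : E) {A : Type*} [CommGroup A] [TopologicalSpace A] [ChartedSpace 𝕜 A]
    (i : A → DilationGroup ℓ) : Prop where
  map_mul : ∀ s t, i (s * t) = i s * i t
  contMDiff : ContMDiff 𝓘(𝕜, 𝕜) 𝓘(𝕜, E) ω i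
  isClosedEmbedding : Topology.IsClosedEmbedding i
  mem_range_iff : ∀ p : DilationGroup ℓ, p ∈ Set.range i ↔ ∃ s : 𝕜, p.toVec = s • v
  tangentImage_eq : ∀ w : GroupLieAlgebra 𝓘(𝕜, E) (DilationGroup ℓ),
    w ∈ tangentImage (𝕜 := 𝕜) (E₁ := 𝕜) i ↔ ∃ s : 𝕜, (w : E) = s • v

/-- The embedding of `(𝕜, +)` onto a line in the kernel of `ℓ`. -/
def addLine (v : E) (hv : ℓ v = 0) (s : Multiplicative 𝕜) : DilationGroup ℓ :=
  ⟨s.toAdd • v, by simp [hv]⟩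

/-- The embedding of `(𝕜 ∖ {0}, ·)` onto the invertible elements of a line that is not in the
kernel of `ℓ`. -/
noncomputable def mulLine (v : E) (hv : ℓ v ≠ 0) (u : 𝕜ˣ) : DilationGroup ℓ :=
  ⟨(((u : 𝕜) - 1) / ℓ v) • v, by simp [hv]⟩

/-- The derivative at `1` sends `x` to `(x * F') • v`; since `F' ≠ 0`, its range is the whole line.
-/
theorem mem_tangentImage_iff {v : E} {A : Type*} [CommGroup A] [TopologicalSpace A]
    [ChartedSpace 𝕜 A] {i : A → DilationGroup ℓ} (hc : Continuous i) {e : A → 𝕜}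
    (he : ∀ x : A, ⇑(extChartAt 𝓘(𝕜, 𝕜) x) = e) {F : 𝕜 → 𝕜} {F' : 𝕜} (hF' : F' ≠ 0)
    (hF : HasDerivAt F F' (e 1)) (h : ∀ x, (i x).toVec = F (e x) • v)
    (w : GroupLieAlgebra 𝓘(𝕜, E) (DilationGroup ℓ)) :
    w ∈ tangentImage (𝕜 := 𝕜) (E₁ := 𝕜) i ↔ ∃ s : 𝕜, (w : E) = s • v := by
  have hd := (hasMFDerivAt_of_globalChart (x := (1 : A)) he DilationGroup.coe_extChartAt
    hc.continuousAt h (hF.smul_const v).hasFDerivAt).mfderiv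
  have hd' (x : 𝕜) : (mfderiv 𝓘(𝕜, 𝕜) 𝓘(𝕜, E) i 1 x : E) = (x * F') • v :=
    (congrArg (fun L : 𝕜 →L[𝕜] E => L x) hd).trans (by simp [smul_smul])
  constructor
  · rintro ⟨x, rfl⟩
    exact ⟨_, hd' x⟩
  · rintro ⟨s, hs⟩
    refine ⟨(s / F' : 𝕜), (hd' _).trans ?_⟩
    rw [div_mul_cancel₀ _ hF']
    exact hs.symm

/-- The form `g` supplies a continuous left inverse, which makes the embedding closed. -/
theorem isLineEmbedding_addLine {v : E} (hv : ℓ v = 0) {g : E →L[𝕜] 𝕜} (hg : g v = 1) :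
    IsLineEmbedding v (addLine (𝕜 := 𝕜) v hv) := by
  have hsm : ContMDiff 𝓘(𝕜, 𝕜) 𝓘(𝕜, E) ω (addLine (𝕜 := 𝕜) v hv) :=
    DilationGroup.contMDiff_iff_toVec
      (((by fun_prop : ContDiff 𝕜 ω fun s : 𝕜 => s • v).contMDiff).comp contMDiff_toAdd)
  refine ⟨fun s t => ?_, hsm, ?_, fun p => ⟨?_, ?_⟩, ?_⟩
  · ext
    change (s.toAdd + t.toAdd) • v = s.toAdd • v + (1 + ℓ (s.toAdd • v)) • t.toAdd • v
    simp [hv, add_smul]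
  · refine Function.LeftInverse.isClosedEmbedding
      (f := fun p => Multiplicative.ofAdd (g p.toVec)) (fun s => ?_) ?_ hsm.continuous
    · change Multiplicative.ofAdd (g (s.toAdd • v)) = s
      simp [hg]
    · exact continuous_ofAdd.comp (g.continuous.comp DilationGroup.isOpenEmbedding_toVec.continuous)
  · rintro ⟨s, rfl⟩
    exact ⟨s.toAdd, rfl⟩
  · rintro ⟨s, hs⟩
    exact ⟨Multiplicative.ofAdd s, DilationGroup.ext hs.symm⟩
  · exact mem_tangentImage_iff hsm.continuous (e := Multiplicative.toAdd) (F := id)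
      (fun _ => rfl) one_ne_zero (hasDerivAt_id _) (fun _ => rfl)

/-- The parameter is the dilation factor: `p ↦ 1 + ℓ p` is a continuous left inverse. -/
theorem isLineEmbedding_mulLine {v : E} (hv : ℓ v ≠ 0) :
    IsLineEmbedding v (mulLine (𝕜 := 𝕜) v hv) := by
  have hsm : ContMDiff 𝓘(𝕜, 𝕜) 𝓘(𝕜, E) ω (mulLine (𝕜 := 𝕜) v hv) :=
    DilationGroup.contMDiff_iff_toVec
      (((by fun_prop : ContDiff 𝕜 ω fun s : 𝕜 => ((s - 1) / ℓ v) • v).contMDiff).comp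
        Units.contMDiff_val)
  refine ⟨fun s t => ?_, hsm, ?_, fun p => ⟨?_, ?_⟩, ?_⟩
  · ext
    change (((s * t : 𝕜) - 1) / ℓ v) • v = (((s : 𝕜) - 1) / ℓ v) • v +
      (1 + ℓ ((((s : 𝕜) - 1) / ℓ v) • v)) • (((t : 𝕜) - 1) / ℓ v) • v
    rw [smul_smul, ← add_smul, map_smul, smul_eq_mul]
    congr 1
    field_simp
    ring
  · refine Function.LeftInverse.isClosedEmbedding
      (f := fun p => Units.mk0 (1 + ℓ p.toVec) p.one_add_ne_zero) (fun u => ?_) ?_ hsm.continuous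
    · ext
      change 1 + ℓ ((((u : 𝕜) - 1) / ℓ v) • v) = u
      simp [hv]
    · refine Units.isOpenEmbedding_val.isEmbedding.continuous_iff.2 ?_
      exact continuous_const.add
        (ℓ.continuous.comp DilationGroup.isOpenEmbedding_toVec.continuous)
  · rintro ⟨s, rfl⟩
    exact ⟨_, rfl⟩
  · rintro ⟨s, hs⟩
    refine ⟨Units.mk0 (1 + ℓ p.toVec) p.one_add_ne_zero, DilationGroup.ext ?_⟩
    change ((1 + ℓ p.toVec - 1) / ℓ v) • v = p.toVec
    rw [hs]
    simp [hv]
  · exact mem_tangentImage_iff hsm.continuous (e := Units.val) (F := fun s => (s - 1) / ℓ v)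
      (fun _ => rfl) (one_div_ne_zero hv) (((hasDerivAt_id _).sub_const 1).div_const _)
      (fun _ => rfl)

end Line

/-! ### The product of the two coordinate lines -/

section Plane

variable {𝕜 : Type*} [RCLike 𝕜] {ℓ : 𝕜 × 𝕜 →L[𝕜] 𝕜}

theorem apply_eq_basis (p : 𝕜 × 𝕜) : ℓ p = p.1 * ℓ (1, 0) + p.2 * ℓ (0, 1) := by
  have h : p = p.1 • ((1, 0) : 𝕜 × 𝕜) + p.2 • ((0, 1) : 𝕜 × 𝕜) := by ext <;> simp
  conv_lhs => rw [h, map_add, map_smul, map_smul, smul_eq_mul, smul_eq_mul]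

/-- The complement of the product of the two coordinate lines is a null set for left Haar measures:
when it is nonempty, it has uncountably many disjoint translates. -/
theorem haar_null_line [MeasurableSpace (DilationGroup ℓ)] [BorelSpace (DilationGroup ℓ)]
    (μ : Measure (DilationGroup ℓ)) [μ.IsHaarMeasure] :
    μ {p | 1 + p.toVec.1 * ℓ (1, 0) = 0} = 0 := by
  by_cases hc : ℓ (0, 1) = 0
  -- Here `1 + ℓ p` depends on the first coordinate only, and its zeros are excluded from the group.
  · convert! measure_empty (μ := μ)
    refine Set.eq_empty_of_forall_notMem fun p hp => p.one_add_ne_zero ?_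
    rw [apply_eq_basis, hc, mul_zero, add_zero]
    exact hp
  -- Left translation by the point of the second axis with dilation factor `exp r` multiplies the
  -- first coordinate by `exp r`. The exponential gives uncountably many distinct nonzero factors.
  set N : ℝ → Set (DilationGroup ℓ) := fun r =>
    {p | 1 + ((Real.exp r : ℝ) : 𝕜) * (p.toVec.1 * ℓ (1, 0)) = 0} with hN
  have hcl (r : ℝ) : IsClosed (N r) :=
    isClosed_eq (continuous_const.add (continuous_const.mul
      ((continuous_fst.comp DilationGroup.isOpenEmbedding_toVec.continuous).mul continuous_const)))
      continuous_const
  have hexp (r : ℝ) : ((Real.exp r : ℝ) : 𝕜) ≠ 0 := by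
    exact_mod_cast (Real.exp_pos r).ne'
  have hdisj : Pairwise (Function.onFun Disjoint N) := by
    intro r s hrs
    refine Set.disjoint_left.2 fun p hp hq => hrs ?_
    simp only [hN, Set.mem_ofPred_eq] at hp hq
    have hx : p.toVec.1 * ℓ (1, 0) ≠ 0 := fun h => by simp [h] at hp
    have h : ((Real.exp r : ℝ) : 𝕜) = ((Real.exp s : ℝ) : 𝕜) :=
      mul_right_cancel₀ hx (add_left_cancel (hp.trans hq.symm))
    exact Real.exp_injective (by exact_mod_cast h)
  have hμ (r : ℝ) : μ (N r) = μ {p | 1 + p.toVec.1 * ℓ (1, 0) = 0} := by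
    refine Eq.trans ?_ (measure_preimage_mul μ (mulLine (0, 1) hc (Units.mk0 _ (hexp r))) _)
    congr 1
    ext p
    have h1 : 1 + ℓ (mulLine (0, 1) hc (Units.mk0 _ (hexp r))).toVec = ((Real.exp r : ℝ) : 𝕜) := by
      change 1 + ℓ (((((Real.exp r : ℝ) : 𝕜) - 1) / ℓ (0, 1)) • (0, 1)) = _
      rw [map_smul, smul_eq_mul, div_mul_cancel₀ _ hc, add_sub_cancel]
    have h2 : (mulLine (0, 1) hc (Units.mk0 _ (hexp r))).toVec.1 = 0 := by
      change ((((Real.exp r : ℝ) : 𝕜) - 1) / ℓ (0, 1)) * 0 = 0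
      simp
    simp only [hN, Set.mem_preimage, Set.mem_ofPred_eq, DilationGroup.toVec_mul, h1, Prod.fst_add,
      h2, Prod.smul_fst, smul_eq_mul, zero_add, mul_assoc]
  by_contra h0
  -- Only countably many disjoint sets can have positive measure, whereas all `N r` have the same
  -- measure.
  have hcount := Measure.countable_meas_pos_of_disjoint_iUnion (μ := μ)
    (fun r => (hcl r).measurableSet) hdisj
  refine Cardinal.not_countable_real (hcount.mono fun r _ => ?_)
  simpa [hμ] using pos_iff_ne_zero.2 h0

theorem isMatchedPairLieGroup_of_isLineEmbedding
    [MeasurableSpace (DilationGroup ℓ)] [BorelSpace (DilationGroup ℓ)]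
    {A : Type*} [CommGroup A] [TopologicalSpace A] [ChartedSpace 𝕜 A]
    {B : Type*} [CommGroup B] [TopologicalSpace B] [ChartedSpace 𝕜 B]
    {i : A → DilationGroup ℓ} {j : B → DilationGroup ℓ}
    (hi : IsLineEmbedding (1, 0) i) (hj : IsLineEmbedding (0, 1) j) :
    IsMatchedPairLieGroup (𝕜 := 𝕜) (E := 𝕜 × 𝕜) (E₁ := 𝕜) (E₂ := 𝕜) i j where
  map_mul_left := hi.map_mul
  -- The source is commutative, so a morphism is also an anti-morphism.
  map_mul_right s t := by rw [mul_comm, hj.map_mul]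
  contMDiff_left := hi.contMDiff
  contMDiff_right := hj.contMDiff
  isClosedEmbedding_left := hi.isClosedEmbedding
  isClosedEmbedding_right := hj.isClosedEmbedding
  range_inter_range := by
    ext p
    rw [Set.mem_inter_iff, hi.mem_range_iff, hj.mem_range_iff, Set.mem_singleton_iff]
    constructor
    · rintro ⟨⟨s, hs⟩, ⟨t, ht⟩⟩
      have h := hs.symm.trans ht
      simp only [Prod.smul_mk, smul_eq_mul, mul_one, mul_zero, Prod.mk.injEq] at h
      ext1
      rw [hs, h.1, zero_smul, DilationGroup.toVec_one]
    · rintro rfl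
      exact ⟨⟨0, by simp [DilationGroup.toVec_one]⟩, ⟨0, by simp [DilationGroup.toVec_one]⟩⟩
  null_compl μ hμ := by
    refine measure_mono_null (fun p hp => ?_) (haar_null_line μ)
    by_contra h
    simp only [Set.mem_ofPred_eq] at h
    refine hp ?_
    set x := p.toVec.1 with hx
    set b := ℓ (1, 0) with hb
    have hl : ℓ (x, 0) = x * b := by rw [apply_eq_basis]; simp [hb]
    have hl' : ℓ (0, p.toVec.2 / (1 + x * b)) = p.toVec.2 / (1 + x * b) * ℓ (0, 1) := by
      rw [apply_eq_basis]; simp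
    have hp1 := p.one_add_ne_zero
    rw [apply_eq_basis, ← hx, ← hb] at hp1
    -- The second factor lies in the group because `(1 + x * b) * (1 + ℓ (0, y)) = 1 + ℓ p` for `y =
    -- p.toVec.2 / (1 + x * b)`.
    have h2 : 1 + ℓ (0, p.toVec.2 / (1 + x * b)) ≠ 0 := by
      rw [hl']
      intro h0
      apply hp1
      field_simp at h0
      linear_combination h0
    obtain ⟨s, hs⟩ := (hi.mem_range_iff ⟨(x, 0), by rwa [hl]⟩).2
      ⟨x, by simp [DilationGroup.toVec]⟩
    obtain ⟨t, ht⟩ := (hj.mem_range_iff ⟨(0, p.toVec.2 / (1 + x * b)), h2⟩).2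
      ⟨p.toVec.2 / (1 + x * b), by simp [DilationGroup.toVec]⟩
    refine ⟨(s, t), DilationGroup.ext ?_⟩
    simp only [hs, ht]
    change ((x, 0) : 𝕜 × 𝕜) + (1 + ℓ (x, 0)) • (0, p.toVec.2 / (1 + x * b)) = p.toVec
    rw [hl]
    ext
    · simp [hx]
    · simp only [Prod.snd_add, Prod.smul_snd, smul_eq_mul, zero_add]
      field_simp

end Plane

/-! ### From the Lie algebra to the matched pair of groups -/

section Exponentiation

variable {𝕜 : Type} [RCLike 𝕜] {𝔤 : Type*} [LieRing 𝔤] [LieAlgebra 𝕜 𝔤]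

/-- A Lie algebra with basis `x, y` is the Lie algebra of `DilationGroup ℓ`, where
`⁅x, y⁆ = ℓ (1, 0) • y - ℓ (0, 1) • x`. -/
noncomputable def groupLieAlgebraEquiv {ℓ : 𝕜 × 𝕜 →L[𝕜] 𝕜} (φ : (𝕜 × 𝕜) ≃ₗ[𝕜] 𝔤)
    (hφ : ⁅φ (1, 0), φ (0, 1)⁆ = ℓ (1, 0) • φ (0, 1) - ℓ (0, 1) • φ (1, 0)) :
    GroupLieAlgebra 𝓘(𝕜, 𝕜 × 𝕜) (DilationGroup ℓ) ≃ₗ⁅𝕜⁆ 𝔤 :=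
  { φ with
    map_lie' := by
      intro v w
      have hb (p : 𝕜 × 𝕜) : φ p = p.1 • φ (1, 0) + p.2 • φ (0, 1) := by
        rw [← map_smul, ← map_smul, ← map_add]; congr 1; ext <;> simp
      have h : φ (⁅v, w⁆ : GroupLieAlgebra 𝓘(𝕜, 𝕜 × 𝕜) (DilationGroup ℓ)) =
          ℓ v • φ w - ℓ w • φ v := by
        rw [DilationGroup.lie_eq]
        exact (map_sub φ _ _).trans (congrArg₂ _ (map_smul φ _ _) (map_smul φ _ _))
      refine h.trans ?_
      change _ = ⁅φ v, φ w⁆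
      rw [hb v, hb w, apply_eq_basis (ℓ := ℓ) v, apply_eq_basis (ℓ := ℓ) w]
      simp only [add_lie, lie_add, smul_lie, lie_smul, lie_self, smul_zero, zero_add, add_zero,
        ← lie_skew (φ (0, 1)) (φ (1, 0)), hφ]
      module }

theorem exponentiatesTo_of_isLineEmbedding {𝔤₁ 𝔤₂ : LieSubalgebra 𝕜 𝔤}
    {ℓ : 𝕜 × 𝕜 →L[𝕜] 𝕜} (φ : (𝕜 × 𝕜) ≃ₗ[𝕜] 𝔤)
    (hφ : ⁅φ (1, 0), φ (0, 1)⁆ = ℓ (1, 0) • φ (0, 1) - ℓ (0, 1) • φ (1, 0))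
    (h₁ : ∀ x, x ∈ 𝔤₁ ↔ ∃ s : 𝕜, x = s • φ (1, 0)) (h₂ : ∀ x, x ∈ 𝔤₂ ↔ ∃ s : 𝕜, x = s • φ (0, 1))
    {A : Type*} [CommGroup A] [TopologicalSpace A] [ChartedSpace 𝕜 A] [LieGroup 𝓘(𝕜, 𝕜) ω A]
    {B : Type*} [CommGroup B] [TopologicalSpace B] [ChartedSpace 𝕜 B] [LieGroup 𝓘(𝕜, 𝕜) ω B]
    {i : A → DilationGroup ℓ} {j : B → DilationGroup ℓ}
    (hi : IsLineEmbedding (1, 0) i) (hj : IsLineEmbedding (0, 1) j) :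
    ExponentiatesTo 𝔤₁ 𝔤₂ (E₁ := 𝕜) (E₂ := 𝕜) A B := by
  have himage {v : 𝕜 × 𝕜} {𝔥 : LieSubalgebra 𝕜 𝔤} (h : ∀ x, x ∈ 𝔥 ↔ ∃ s : 𝕜, x = s • φ v)
      {T : Set (𝕜 × 𝕜)} (hT : ∀ w, w ∈ T ↔ ∃ s : 𝕜, w = s • v) : φ '' T = (𝔥 : Set 𝔤) := by
    ext x
    rw [SetLike.mem_coe, h]
    constructor
    · rintro ⟨w, hw, rfl⟩
      obtain ⟨s, rfl⟩ := (hT w).1 hw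
      exact ⟨s, map_smul φ _ _⟩
    · rintro ⟨s, rfl⟩
      exact ⟨s • v, (hT _).2 ⟨s, rfl⟩, map_smul φ _ _⟩
  let : MeasurableSpace (DilationGroup ℓ) := borel _
  have : BorelSpace (DilationGroup ℓ) := ⟨rfl⟩
  exact ⟨𝕜 × 𝕜, inferInstance, inferInstance, inferInstance, inferInstance, DilationGroup ℓ,
    inferInstance, inferInstance, inferInstance, inferInstance, inferInstance, inferInstance,
    inferInstance, inferInstance, i, j, groupLieAlgebraEquiv φ hφ,
    isMatchedPairLieGroup_of_isLineEmbedding hi hj, himage h₁ hi.tangentImage_eq,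
    himage h₂ hj.tangentImage_eq⟩

theorem exponentiatesToAddOrMul {𝔤₁ 𝔤₂ : LieSubalgebra 𝕜 𝔤}
    (h : IsMatchedPairLieAlgebra 𝔤₁ 𝔤₂) (h₁ : Module.finrank 𝕜 𝔤₁ = 1)
    (h₂ : Module.finrank 𝕜 𝔤₂ = 1) : ExponentiatesToAddOrMul 𝔤₁ 𝔤₂ := by
  have key (𝔥 : LieSubalgebra 𝕜 𝔤) (h : Module.finrank 𝕜 𝔥 = 1) :
      ∃ e : 𝕜 ≃ₗ[𝕜] 𝔥.toSubmodule, ∀ x, x ∈ 𝔥 ↔ ∃ s : 𝕜, x = s • (e 1 : 𝔤) := by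
    have e : 𝕜 ≃ₗ[𝕜] 𝔥.toSubmodule :=
      haveI : FiniteDimensional 𝕜 𝔥.toSubmodule := Module.finite_of_finrank_eq_succ h
      LinearEquiv.ofFinrankEq _ _ ((Module.finrank_self 𝕜).trans h.symm)
    refine ⟨e, fun x => ⟨fun hx => ⟨e.symm ⟨x, hx⟩, ?_⟩, ?_⟩⟩
    · rw [← Submodule.coe_smul, ← map_smul, smul_eq_mul, mul_one, LinearEquiv.apply_symm_apply]
    · rintro ⟨s, rfl⟩
      exact 𝔥.smul_mem s (e 1).2
  obtain ⟨e₁, he₁⟩ := key 𝔤₁ h₁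
  obtain ⟨e₂, he₂⟩ := key 𝔤₂ h₂
  let φ : (𝕜 × 𝕜) ≃ₗ[𝕜] 𝔤 := (e₁.prodCongr e₂).trans (Submodule.prodEquivOfIsCompl _ _ h)
  have hx : φ (1, 0) = e₁ 1 :=
    (Submodule.coe_prodEquivOfIsCompl' _ _ h (e₁.prodCongr e₂ (1, 0))).trans (by simp)
  have hy : φ (0, 1) = e₂ 1 :=
    (Submodule.coe_prodEquivOfIsCompl' _ _ h (e₁.prodCongr e₂ (0, 1))).trans (by simp)
  rw [← hx] at he₁
  rw [← hy] at he₂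
  set c := φ.symm ⁅φ (1, 0), φ (0, 1)⁆ with hc
  -- Comparing the coordinates `c` of the bracket with `ℓ (1, 0) • y - ℓ (0, 1) • x` forces `ℓ (1,
  -- 0) = c.2` and `ℓ (0, 1) = -c.1`.
  let ℓ : 𝕜 × 𝕜 →L[𝕜] 𝕜 :=
    c.2 • ContinuousLinearMap.fst 𝕜 𝕜 𝕜 - c.1 • ContinuousLinearMap.snd 𝕜 𝕜 𝕜
  have hφ : ⁅φ (1, 0), φ (0, 1)⁆ = ℓ (1, 0) • φ (0, 1) - ℓ (0, 1) • φ (1, 0) := by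
    rw [← map_smul, ← map_smul, ← map_sub, ← LinearEquiv.symm_apply_eq, ← hc]
    ext <;> simp [ℓ]
  have hfst : ContinuousLinearMap.fst 𝕜 𝕜 𝕜 (1, 0) = 1 := rfl
  have hsnd : ContinuousLinearMap.snd 𝕜 𝕜 𝕜 (0, 1) = 1 := rfl
  -- Each factor is additive or multiplicative according to whether `ℓ` vanishes on its axis.
  by_cases hb : ℓ (1, 0) = 0 <;> by_cases ha : ℓ (0, 1) = 0
  · exact .inl (exponentiatesTo_of_isLineEmbedding φ hφ he₁ he₂
      (isLineEmbedding_addLine hb hfst) (isLineEmbedding_addLine ha hsnd))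
  · exact .inr (.inl (exponentiatesTo_of_isLineEmbedding φ hφ he₁ he₂
      (isLineEmbedding_addLine hb hfst) (isLineEmbedding_mulLine ha)))
  · exact .inr (.inr (.inl (exponentiatesTo_of_isLineEmbedding φ hφ he₁ he₂
      (isLineEmbedding_mulLine hb) (isLineEmbedding_addLine ha hsnd))))
  · exact .inr (.inr (.inr (exponentiatesTo_of_isLineEmbedding φ hφ he₁ he₂
      (isLineEmbedding_mulLine hb) (isLineEmbedding_mulLine ha))))

end Exponentiation

end LieMatchedPair

theorem mainTheorem9 :
    (∀ (𝔤 : Type*) [LieRing 𝔤] [LieAlgebra ℂ 𝔤] (𝔤₁ 𝔤₂ : LieSubalgebra ℂ 𝔤),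
      LieMatchedPair.IsMatchedPairLieAlgebra 𝔤₁ 𝔤₂ →
      Module.finrank ℂ 𝔤₁ = 1 → Module.finrank ℂ 𝔤₂ = 1 →
      LieMatchedPair.ExponentiatesToAddOrMul 𝔤₁ 𝔤₂) ∧
    (∀ (𝔤 : Type*) [LieRing 𝔤] [LieAlgebra ℝ 𝔤] (𝔤₁ 𝔤₂ : LieSubalgebra ℝ 𝔤),
      LieMatchedPair.IsMatchedPairLieAlgebra 𝔤₁ 𝔤₂ →
      Module.finrank ℝ 𝔤₁ = 1 → Module.finrank ℝ 𝔤₂ = 1 →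
      LieMatchedPair.ExponentiatesToAddOrMul 𝔤₁ 𝔤₂) :=
  ⟨fun _ _ _ _ _ h h₁ h₂ => LieMatchedPair.exponentiatesToAddOrMul h h₁ h₂,
    fun _ _ _ _ _ h h₁ h₂ => LieMatchedPair.exponentiatesToAddOrMul h h₁ h₂⟩
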